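/- Let $a>0$, $\gamma\ge 1$, $\rho_s>0$, $\mu>0$, $\kappa>0$ and let $\mathcal O_1,\mathcal O_2,\mathcal O_3\subseteq(0,\pi)$ be open sets (possibly $\mathcal O_2=(0,\pi)$) such that $(0,\pi)\setminus\overline{\mathcal O_1\cup\mathcal O_3}$ is nonempty. For $T>0$ consider the one-dimensional compressible Navier–Stokes system with Maxwell's law, linearized around $(\rho_s,0,0)$, $$ \begin{cases} \partial_t\rho+\rho_s\,\partial_x u=\mathbf 1_{\mathcal O_1}f_1 & \text{in }(0,T)\times(0,\pi),\\ \partial_t u+a\gamma\rho_s^{\gamma-2}\,\partial_x\rho-\frac1{\rho_s}\,\partial_x S=\mathbf 1_{\mathcal O_2}f_2 & \text{in }(0,T)\times(0,\pi),\\ \partial_t S+\frac1\kappa S-\frac\mu\kappa\,\partial_x u=\mathbf 1_{\mathcal O_3}f_3 & \text{in }(0,T)\times(0,\pi),\\ u(t,0)=u(t,\pi)=0 & \text{for } t\in(0,T),\\ (\rho,u,S)(0)=(\rho_0,u_0,S_0) & \text{in }(0,\pi), \end{cases} $$ with real- or complex-valued unknowns. For $(\rho_0,u_0,S_0)\in (L^2(0,\pi))^3$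 and $f_i\in L^2(0,T;L^2(\mathcal O_i))$, the solution is the function $(\rho,u,S)\in C([0,T];(L^2(0,\pi))^3)$ that takes the initial value $(\rho_0,u_0,S_0)$ and satisfies the equations in the following weak sense: for all $t\in[0,T]$, $\psi\in C^\infty([0,\pi])$ and $\varphi\in C_c^\infty(0,\pi)$, $$ \begin{aligned} \int_0^\pi\rho(t)\psi\,dx&=\int_0^\pi\rho_0\psi\,dx+\int_0^t\Big(\rho_s\int_0^\pi u\,\psi'\,dx+\int_{\mathcal O_1}f_1\psi\,dx\Big)ds,\\ \int_0^\pi u(t)\varphi\,dx&=\int_0^\pi u_0\varphi\,dx+\int_0^t\Big(\int_0^\pi\big(a\gamma\rho_s^{\gamma-2}\rho-\tfrac1{\rho_s}S\big)\varphi'\,dx+\int_{\mathcal O_2}f_2\varphi\,dx\Big)ds,\\ \int_0^\pi S(t)\psi\,dx&=\int_0^\pi S_0\psi\,dx+\int_0^t\Big(-\tfrac1\kappa\int_0^\pi S\psi\,dx-\tfrac\mu\kappa\int_0^\pi u\,\psi'\,dx+\int_{\mathcal O_3}f_3\psi\,dx\Big)ds . \end{aligned} $$ The system is called null controllable in $(L^2(0,\pi))^3$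 at time $T$ if for every $(\rho_0,u_0,S_0)\in(L^2(0,\pi))^3$ there are controls $f_i\in L^2(0,T;L^2(\mathcal O_i))$, $i=1,2,3$, such that the corresponding solution satisfies $(\rho,u,S)(T)=(0,0,0)$. Then, for every $T>0$, the system is not null controllable in $(L^2(0,\pi))^3$ at time $T$. -/

import Mathlib

open MeasureTheory Set
open scoped ContDiff

/-- The Lebesgue space `L²(O)` of (classes of) square-integrable functions on `O ⊆ ℝ`. -/
abbrev L2 (𝕜 : Type*) [RCLike 𝕜] (O : Set ℝ) : Type _ :=
  Lp 𝕜 2 (volume.restrict O)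

/-- The Bochner space `L²(0, T; L²(O))`. -/
abbrev L2L2 (𝕜 : Type*) [RCLike 𝕜] (T : ℝ) (O : Set ℝ) : Type _ :=
  Lp (L2 𝕜 O) 2 (volume.restrict (Ioo 0 T))

/-- `(ρ, u, S) ∈ C([0, T]; L²(0, π)³)` is the solution of
```
∂ₜ ρ + ρs ∂ₓ u                              = 1_{O₁} f₁,
∂ₜ u + a γ ρs ^ (γ - 2) ∂ₓ ρ - (1 / ρs) ∂ₓ S = 1_{O₂} f₂,
∂ₜ S + (1 / κ) S - (μ / κ) ∂ₓ u              = 1_{O₃} f₃     in (0, T) × (0, π),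
(ρ, u, S)(0) = (ρ₀, u₀, S₀),   u(t, 0) = u(t, π) = 0,
```
in the weak sense: each equation is integrated in time over `(0, t)`, multiplied by a smooth
function of `x`, and the `x`-derivatives are moved to that function. In the equations for `ρ` and
`S` the test function is smooth up to the boundary of `(0, π)` and need not vanish there: the
absence of the boundary terms `u ψ` at `0` and `π` expresses the Dirichlet condition. -/
structure IsSolution {𝕜 : Type*} [RCLike 𝕜] (a γ ρs μ κ : ℝ) (O₁ O₂ O₃ : Set ℝ) (T : ℝ)
    (f₁ : L2L2 𝕜 T O₁) (f₂ : L2L2 𝕜 T O₂) (f₃ : L2L2 𝕜 T O₃)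
    (ρ₀ u₀ S₀ : L2 𝕜 (Ioo 0 Real.pi)) (ρ u S : ℝ → L2 𝕜 (Ioo 0 Real.pi)) : Prop where
  continuousOn_density : ContinuousOn ρ (Icc 0 T)
  continuousOn_velocity : ContinuousOn u (Icc 0 T)
  continuousOn_stress : ContinuousOn S (Icc 0 T)
  initial_density : ρ 0 = ρ₀
  initial_velocity : u 0 = u₀
  initial_stress : S 0 = S₀
  density_eq : ∀ ψ : ℝ → ℝ, ContDiff ℝ ∞ ψ → ∀ t ∈ Icc 0 T,
    ∫ x in Ioo 0 Real.pi, ψ x • ρ t x =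
      (∫ x in Ioo 0 Real.pi, ψ x • ρ₀ x) +
        ∫ s in (0 : ℝ)..t,
          (ρs • (∫ x in Ioo 0 Real.pi, deriv ψ x • u s x) + ∫ x in O₁, ψ x • f₁ s x)
  velocity_eq : ∀ φ : ℝ → ℝ, ContDiff ℝ ∞ φ → HasCompactSupport φ →
    tsupport φ ⊆ Ioo 0 Real.pi → ∀ t ∈ Icc 0 T,
    ∫ x in Ioo 0 Real.pi, φ x • u t x =
      (∫ x in Ioo 0 Real.pi, φ x • u₀ x) +
        ∫ s in (0 : ℝ)..t,
          ((a * γ * ρs ^ (γ - 2)) • (∫ x in Ioo 0 Real.pi, deriv φ x • ρ s x)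
            - (1 / ρs) • (∫ x in Ioo 0 Real.pi, deriv φ x • S s x)
            + ∫ x in O₂, φ x • f₂ s x)
  stress_eq : ∀ ψ : ℝ → ℝ, ContDiff ℝ ∞ ψ → ∀ t ∈ Icc 0 T,
    ∫ x in Ioo 0 Real.pi, ψ x • S t x =
      (∫ x in Ioo 0 Real.pi, ψ x • S₀ x) +
        ∫ s in (0 : ℝ)..t,
          (-((1 / κ) • ∫ x in Ioo 0 Real.pi, ψ x • S s x)
            - (μ / κ) • (∫ x in Ioo 0 Real.pi, deriv ψ x • u s x)
            + ∫ x in O₃, ψ x • f₃ s x)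

/-- Null controllability in `L²(0, π)³` at time `T`: every initial state is driven to zero at
time `T` by some controls `fᵢ ∈ L²(0, T; L²(Oᵢ))`. -/
def NullControllable (𝕜 : Type*) [RCLike 𝕜] (a γ ρs μ κ : ℝ) (O₁ O₂ O₃ : Set ℝ) (T : ℝ) : Prop :=
  ∀ ρ₀ u₀ S₀ : L2 𝕜 (Ioo 0 Real.pi),
    ∃ (f₁ : L2L2 𝕜 T O₁) (f₂ : L2L2 𝕜 T O₂) (f₃ : L2L2 𝕜 T O₃)
      (ρ u S : ℝ → L2 𝕜 (Ioo 0 Real.pi)),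
      IsSolution a γ ρs μ κ O₁ O₂ O₃ T f₁ f₂ f₃ ρ₀ u₀ S₀ ρ u S ∧
        ρ T = 0 ∧ u T = 0 ∧ S T = 0

/-! A jump of the density outside `closure (O₁ ∪ O₃)` can neither move nor vanish in finite time,
whatever `f₂` does. There, with `m = μ / κ`, the combination `m ρ + ρs S` loses `∂ₓ u` from its
evolution. Its `x`-derivative, corrected by a multiple of `u` that uses the velocity equation to
trade `∂ₓ S` for a multiple of `∂ₓ (m ρ + ρs S)`, obeys at each `x` a damped ODE in time whose
forcing lies in `L²`. Dually, for test functions `H` supported off the controls, `F = m ⟨ρ, H'⟩ + ρs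
⟨S, H'⟩ + β ⟨u, H⟩` satisfies `F' = -c F + O(‖H‖)` with `‖H‖` the `L²` norm. If `F T = 0`, then `|F
0| ≤ C ‖H‖` with `C` independent of `H` (`exists_norm_initial_pairing_le`). For `u₀ = S₀ = 0` and
`ρ₀` a step at `x₀`, `F 0 = -m H(x₀)`, and evaluation at a point is not bounded in `L²`: narrow
bumps give the contradiction. -/

/-- A continuous solution of `F' = -c F + h` in integrated form that vanishes at time `T` has
initial value bounded by the primitive of `h`. -/
lemma norm_initial_le_of_final_eq_zero {𝕜 : Type*} [RCLike 𝕜] {F h : ℝ → 𝕜} {c T M : ℝ}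
    (hc : 0 ≤ c) (hT : 0 < T) (hF : ContinuousOn F (Icc 0 T))
    (hh : IntervalIntegrable h volume 0 T)
    (hFeq : ∀ t ∈ Icc 0 T, F t = F 0 + ∫ s in (0 : ℝ)..t, (-(c • F s) + h s))
    (hFT : F T = 0) (hM : ∀ t ∈ Icc 0 T, ‖∫ s in (0 : ℝ)..t, h s‖ ≤ M) :
    ‖F 0‖ ≤ (1 + c * T) * Real.exp (c * T) * M := by
  set K : ℝ → 𝕜 := fun t => ∫ s in (0 : ℝ)..t, h s with hK
  have hint : ∀ t ∈ Icc 0 T, IntervalIntegrable F volume 0 t := fun t ht =>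
    (hF.mono (by rw [uIcc_of_le ht.1]; exact Icc_subset_Icc_right ht.2)).intervalIntegrable
  have hw : ∀ t ∈ Icc 0 T, F t - K t = F 0 - c • ∫ s in (0 : ℝ)..t, F s := by
    intro t ht
    have hht : IntervalIntegrable h volume 0 t := hh.mono_set (by
      rw [uIcc_of_le ht.1, uIcc_of_le hT.le]; exact Icc_subset_Icc_right ht.2)
    have hcF : IntervalIntegrable (fun s => -(c • F s)) volume 0 t := ((hint t ht).smul c).neg
    rw [hFeq t ht, intervalIntegral.integral_add hcF hht,
      intervalIntegral.integral_neg, intervalIntegral.integral_smul]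
    simp only [hK]
    ring
  -- `F` need not be differentiable, as `h` is only integrable, but `w = F - K` is: `w' = -c (w +
  -- K)`. The integrating factor leaves `v' = -c exp(c t) K`, which involves `h` only through its
  -- primitive.
  set v : ℝ → 𝕜 := fun t => Real.exp (c * t) • (F 0 - c • ∫ s in (0 : ℝ)..t, F s) with hv
  have hderiv : ∀ t ∈ Icc 0 T, HasDerivWithinAt v (-((c * Real.exp (c * t)) • K t)) (Icc 0 T) t := by
    intro t ht
    have h1 : HasDerivWithinAt (fun t => ∫ s in (0 : ℝ)..t, F s) (F t) (Icc 0 T) t := by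
      have : Fact (t ∈ Icc 0 T) := ⟨ht⟩
      exact intervalIntegral.integral_hasDerivWithinAt_right (hint t ht)
        (hF.stronglyMeasurableAtFilter_nhdsWithin measurableSet_Icc t) (hF t ht)
    have h2 : HasDerivWithinAt (fun t => Real.exp (c * t)) (c * Real.exp (c * t)) (Icc 0 T) t := by
      simpa [mul_comm] using (((hasDerivAt_id t).const_mul c).exp).hasDerivWithinAt
    have h3 := h2.smul ((h1.const_smul c).const_sub (F 0))
    refine h3.congr_deriv ?_
    simp only [Pi.smul_apply]
    rw [← hw t ht]
    simp only [smul_sub, smul_neg, smul_smul, mul_comm (Real.exp (c * t)) c]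
    abel
  have hM0 : 0 ≤ M := (norm_nonneg _).trans (hM T ⟨hT.le, le_rfl⟩)
  have hbound := norm_image_sub_le_of_norm_deriv_le_segment' hderiv
    (C := c * Real.exp (c * T) * M) (fun t ht => by
      rw [norm_neg, norm_smul, Real.norm_of_nonneg (by positivity)]
      have : Real.exp (c * t) ≤ Real.exp (c * T) := by
        gcongr; exact ht.2.le
      gcongr
      exact hM t ⟨ht.1, ht.2.le⟩) T ⟨hT.le, le_rfl⟩
  have hv0 : v 0 = F 0 := by simp [hv]
  have hvT : v T = -(Real.exp (c * T) • K T) := by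
    simp only [hv]
    rw [← hw T ⟨hT.le, le_rfl⟩, hFT]
    simp
  have hvTn : ‖v T‖ ≤ Real.exp (c * T) * M := by
    rw [hvT, norm_neg, norm_smul, Real.norm_of_nonneg (by positivity)]
    gcongr
    exact hM T ⟨hT.le, le_rfl⟩
  calc ‖F 0‖ = ‖v T - (v T - v 0)‖ := by rw [← hv0]; congr 1; ring
    _ ≤ ‖v T‖ + ‖v T - v 0‖ := norm_sub_le _ _
    _ ≤ Real.exp (c * T) * M + c * Real.exp (c * T) * M * (T - 0) := add_le_add hvTn hbound
    _ = (1 + c * T) * Real.exp (c * T) * M := by ring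

/-- Integration against a real square-integrable function, as a bounded functional on `L²`. -/
lemma exists_pairing (𝕜 : Type*) [RCLike 𝕜] {ν : Measure ℝ} {φ : ℝ → ℝ} (hφ : MemLp φ 2 ν) :
    ∃ L : Lp 𝕜 2 ν →L[ℝ] 𝕜, (∀ f, L f = ∫ x, φ x • f x ∂ν) ∧
      ∀ f, ‖L f‖ ≤ (eLpNorm φ 2 ν).toReal * ‖f‖ := by
  have hφ' : MemLp (fun x => (φ x : 𝕜)) 2 ν := hφ.ofReal
  have hL : ∀ f : Lp 𝕜 2 ν, inner 𝕜 (hφ'.toLp _) f = ∫ x, φ x • f x ∂ν := by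
    intro f
    rw [L2.inner_def]
    refine integral_congr_ae ?_
    filter_upwards [hφ'.coeFn_toLp] with x hx
    rw [hx, RCLike.inner_apply, RCLike.conj_ofReal, RCLike.real_smul_eq_coe_mul, mul_comm]
  refine ⟨(innerSL 𝕜 (hφ'.toLp _)).restrictScalars ℝ, hL, fun f => ?_⟩
  refine (norm_inner_le_norm (𝕜 := 𝕜) (hφ'.toLp _) f).trans_eq ?_
  rw [Lp.norm_toLp]
  congr 2
  exact eLpNorm_congr_norm_ae (Filter.Eventually.of_forall fun x => by simp)

/-- Bump functions with arbitrarily small support and `L²` norm. -/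
lemma exists_bump_eLpNorm_le (x₀ : ℝ) {U : Set ℝ} (hU : U ∈ nhds x₀) {η : ℝ} (hη : 0 < η) :
    ∃ H : ℝ → ℝ, ContDiff ℝ ∞ H ∧ HasCompactSupport H ∧ tsupport H ⊆ U ∧ H x₀ = 1 ∧
      eLpNorm H 2 volume ≤ ENNReal.ofReal η := by
  obtain ⟨δ, hδ, hδU⟩ := Metric.mem_nhds_iff.1 hU
  -- The bump is at most the indicator of an interval of length `2 ε ≤ η ^ 2`.
  set ε := min (δ / 2) (η ^ 2 / 2) with hε
  have hε0 : 0 < ε := by positivity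
  let H : ContDiffBump x₀ := ⟨ε / 2, ε, by positivity, by linarith⟩
  refine ⟨H, H.contDiff, H.hasCompactSupport, ?_, ?_, ?_⟩
  · rw [H.tsupport_eq]
    exact (Metric.closedBall_subset_ball ((min_le_left _ _).trans_lt (by linarith))).trans hδU
  · exact H.one_of_mem_closedBall (Metric.mem_closedBall_self H.rIn_pos.le)
  · calc eLpNorm H 2 volume
        ≤ eLpNorm ((Metric.closedBall x₀ ε).indicator fun _ => (1 : ℝ)) 2 volume := by
          refine eLpNorm_mono_real fun x => ?_
          by_cases hx : x ∈ Metric.closedBall x₀ ε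
          · simpa [hx, abs_of_nonneg H.nonneg] using H.le_one
          · have : H x = 0 := H.zero_of_le_dist (by
              rw [Metric.mem_closedBall, not_le] at hx; exact hx.le)
            simp [hx, this]
      _ = (ENNReal.ofReal (2 * ε)) ^ (1 / 2 : ℝ) := by
          rw [eLpNorm_indicator_const Metric.isClosed_closedBall.measurableSet (by simp) (by simp),
            Real.volume_closedBall]
          simp
      _ ≤ (ENNReal.ofReal (η ^ 2)) ^ (1 / 2 : ℝ) := by
          gcongr
          linarith [min_le_right (δ / 2) (η ^ 2 / 2)]
      _ = ENNReal.ofReal η := by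
          rw [ENNReal.ofReal_rpow_of_nonneg (by positivity) (by norm_num), ← Real.sqrt_eq_rpow,
            Real.sqrt_sq hη.le]

/-- Along a solution driven to zero, the initial state `μ / κ ρ₀ + ρs S₀` has a weak derivative in
`L²` away from `O₁ ∪ O₃`, modulo `u₀`. -/
lemma exists_norm_initial_pairing_le {𝕜 : Type*} [RCLike 𝕜] {a γ ρs μ κ : ℝ}
    (ha : 0 < a) (hγ : 1 ≤ γ) (hρs : 0 < ρs) (hμ : 0 < μ) (hκ : 0 < κ)
    {O₁ O₂ O₃ : Set ℝ} {T : ℝ} (hT : 0 < T)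
    {f₁ : L2L2 𝕜 T O₁} {f₂ : L2L2 𝕜 T O₂} {f₃ : L2L2 𝕜 T O₃}
    {ρ₀ u₀ S₀ : L2 𝕜 (Ioo 0 Real.pi)} {ρ u S : ℝ → L2 𝕜 (Ioo 0 Real.pi)}
    (h : IsSolution a γ ρs μ κ O₁ O₂ O₃ T f₁ f₂ f₃ ρ₀ u₀ S₀ ρ u S)
    (hρT : ρ T = 0) (huT : u T = 0) (hST : S T = 0) :
    ∃ β C : ℝ, 0 ≤ C ∧ ∀ H : ℝ → ℝ, ContDiff ℝ ∞ H → HasCompactSupport H →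
      tsupport H ⊆ Ioo 0 Real.pi \ closure (O₁ ∪ O₃) →
      ‖(μ / κ) • (∫ x in Ioo 0 Real.pi, deriv H x • ρ₀ x)
        + ρs • (∫ x in Ioo 0 Real.pi, deriv H x • S₀ x)
        + β • (∫ x in Ioo 0 Real.pi, H x • u₀ x)‖ ≤ C * (eLpNorm H 2 volume).toReal := by
  set m := μ / κ with hm
  set b := a * γ * ρs ^ (γ - 2) with hb
  have hm0 : 0 < m := by positivity
  have hb0 : 0 < b := by have := Real.rpow_pos_of_pos hρs (γ - 2); positivity
  -- `c` and `β` solve `β b = -c m` and `ρs / κ + β / ρs = c ρs`, the matching of the `ρ` and `S`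
  -- coefficients in `F' = -c F + forcing`.
  set c := (ρs ^ 2 / κ) / (ρs ^ 2 + m / b) with hc
  have hc0 : 0 < c := by positivity
  set β := -(m * c / b) with hβ
  have hβb : β * b = -(c * m) := by rw [hβ]; field_simp
  have hβr : ρs / κ + β / ρs = c * ρs := by
    have : c * (ρs ^ 2 + m / b) = ρs ^ 2 / κ := by rw [hc]; field_simp
    have h2 : ρs / κ = (ρs ^ 2 / κ) / ρs := by field_simp
    rw [h2, ← this, hβ]
    field_simp
    ring
  have hf₂ : Integrable f₂ (volume.restrict (Ioo 0 T)) :=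
    (Lp.memLp f₂).integrable (by norm_num)
  have hf₂i : IntervalIntegrable f₂ volume 0 T := by
    rw [intervalIntegrable_iff_integrableOn_Ioo_of_le hT.le]; exact hf₂
  have hui : IntervalIntegrable u volume 0 T :=
    (h.continuousOn_velocity.mono (by rw [uIcc_of_le hT.le])).intervalIntegrable
  -- The part of the forcing bound that does not depend on `H`; this makes the final constant
  -- uniform in `H`.
  set R : ℝ := ∫ s in (0 : ℝ)..T, (|c * β| * ‖u s‖ + |β| * ‖f₂ s‖) with hR
  have hRint : IntervalIntegrable (fun s => |c * β| * ‖u s‖ + |β| * ‖f₂ s‖) volume 0 T :=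
    (hui.norm.const_mul _).add (hf₂i.norm.const_mul _)
  have hR0 : 0 ≤ R := intervalIntegral.integral_nonneg hT.le fun s _ => by positivity
  refine ⟨β, (1 + c * T) * Real.exp (c * T) * R, by positivity, fun H hH hHc hHs => ?_⟩
  have hH' : ContDiff ℝ ∞ (deriv H) := ((contDiff_infty_iff_deriv).1 hH).2
  have hH'c : HasCompactSupport (deriv H) := hHc.deriv
  have hH'' : ContDiff ℝ ∞ (deriv (deriv H)) := ((contDiff_infty_iff_deriv).1 hH').2
  have hmem : MemLp H 2 volume := hH.continuous.memLp_of_hasCompactSupport hHc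
  have hN : ∀ O : Set ℝ, (eLpNorm H 2 (volume.restrict O)).toReal ≤ (eLpNorm H 2 volume).toReal :=
    fun O => ENNReal.toReal_mono hmem.2.ne (eLpNorm_mono_measure _ Measure.restrict_le_self)
  set N := (eLpNorm H 2 volume).toReal
  have hzero : ∀ x ∈ O₁ ∪ O₃, deriv H x = 0 := fun x hx => by
    by_contra hne
    exact (hHs (support_deriv_subset hne)).2 (subset_closure hx)
  obtain ⟨P, hP, hPn⟩ := exists_pairing 𝕜 (hmem.restrict (Ioo 0 Real.pi))
  obtain ⟨Q, hQ, hQn⟩ := exists_pairing 𝕜 (hmem.restrict O₂)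
  obtain ⟨P', hP', -⟩ := exists_pairing 𝕜
    ((hH'.continuous.memLp_of_hasCompactSupport (μ := volume) (p := 2) hH'c).restrict (Ioo 0 Real.pi))
  obtain ⟨P'', hP'', -⟩ := exists_pairing 𝕜 ((hH''.continuous.memLp_of_hasCompactSupport
    (μ := volume) (p := 2) hH'c.deriv).restrict (Ioo 0 Real.pi))
  -- Density and stress are tested with `H'`, velocity with `H`. Since `H'` vanishes on `O₁ ∪ O₃`,
  -- the controls `f₁` and `f₃` drop out.
  have e₁ : ∀ t ∈ Icc 0 T, P' (ρ t) = P' ρ₀ + ∫ s in (0 : ℝ)..t, ρs • P'' (u s) := by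
    intro t ht
    simp only [hP', hP'']
    rw [h.density_eq _ hH' t ht]
    congr 2 with s
    rw [setIntegral_eq_zero_of_forall_eq_zero (t := O₁)
      fun x hx => by rw [hzero x (Or.inl hx), zero_smul], add_zero]
  have e₂ : ∀ t ∈ Icc 0 T, P (u t) = P u₀ +
      ∫ s in (0 : ℝ)..t, (b • P' (ρ s) - (1 / ρs) • P' (S s) + Q (f₂ s)) := by
    intro t ht
    simp only [hP', hP, hQ]
    exact h.velocity_eq _ hH hHc (fun x hx => (hHs hx).1) t ht
  have e₃ : ∀ t ∈ Icc 0 T, P' (S t) = P' S₀ +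
      ∫ s in (0 : ℝ)..t, (-((1 / κ) • P' (S s)) - m • P'' (u s)) := by
    intro t ht
    simp only [hP', hP'']
    rw [h.stress_eq _ hH' t ht]
    congr 2 with s
    rw [setIntegral_eq_zero_of_forall_eq_zero (t := O₃)
      fun x hx => by rw [hzero x (Or.inr hx), zero_smul], add_zero]
  set F : ℝ → 𝕜 := fun t => m • P' (ρ t) + ρs • P' (S t) + β • P (u t) with hFdef
  have cρ : ContinuousOn (fun t => P' (ρ t)) (Icc 0 T) :=
    P'.continuous.comp_continuousOn h.continuousOn_density
  have cS : ContinuousOn (fun t => P' (S t)) (Icc 0 T) :=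
    P'.continuous.comp_continuousOn h.continuousOn_stress
  have cu : ContinuousOn (fun t => P (u t)) (Icc 0 T) :=
    P.continuous.comp_continuousOn h.continuousOn_velocity
  have cu'' : ContinuousOn (fun t => P'' (u t)) (Icc 0 T) :=
    P''.continuous.comp_continuousOn h.continuousOn_velocity
  have hQi : IntervalIntegrable (fun s => Q (f₂ s)) volume 0 T := by
    rw [intervalIntegrable_iff_integrableOn_Ioo_of_le hT.le]
    exact Q.integrable_comp hf₂
  have hPi : IntervalIntegrable (fun s => P (u s)) volume 0 T :=
    (cu.mono (by rw [uIcc_of_le hT.le])).intervalIntegrable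
  have hh : IntervalIntegrable (fun s => (c * β) • P (u s) + β • Q (f₂ s)) volume 0 T :=
    (hPi.smul (c * β)).add (hQi.smul β)
  have hF0 : F 0 = m • P' ρ₀ + ρs • P' S₀ + β • P u₀ := by
    simp only [hFdef, h.initial_density, h.initial_velocity, h.initial_stress]
  have key := norm_initial_le_of_final_eq_zero (F := F)
    (h := fun s => (c * β) • P (u s) + β • Q (f₂ s)) (c := c) (T := T) (M := R * N) hc0.le hT
    (((cρ.const_smul m).add (cS.const_smul ρs)).add (cu.const_smul β))
    hh ?_ ?_ ?_
  · rw [hF0, hP', hP', hP] at key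
    exact key.trans_eq (by ring)
  · intro t ht
    have hsub : uIcc 0 t ⊆ Icc 0 T := by
      rw [uIcc_of_le ht.1]; exact Icc_subset_Icc_right ht.2
    have iρ := (cρ.mono hsub).intervalIntegrable (μ := volume)
    have iS := (cS.mono hsub).intervalIntegrable (μ := volume)
    have iu'' := (cu''.mono hsub).intervalIntegrable (μ := volume)
    have iQ : IntervalIntegrable (fun s => Q (f₂ s)) volume 0 t :=
      hQi.mono_set (by rwa [uIcc_of_le hT.le])
    rw [hF0]
    simp only [hFdef]
    rw [e₁ t ht, e₂ t ht, e₃ t ht]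
    simp only [smul_add, ← intervalIntegral.integral_smul]
    have iA : IntervalIntegrable (fun s => m • ρs • P'' (u s)) volume 0 t :=
      (iu''.smul ρs).smul m
    have iB : IntervalIntegrable (fun s => ρs • (-((1 / κ) • P' (S s)) - m • P'' (u s)))
        volume 0 t :=
      ((iS.smul (1 / κ)).neg.sub (iu''.smul m)).smul ρs
    have iD : IntervalIntegrable (fun s => β • (b • P' (ρ s) - (1 / ρs) • P' (S s))
        + β • Q (f₂ s)) volume 0 t :=
      (((iρ.smul b).sub (iS.smul (1 / ρs))).smul β).add (iQ.smul β)
    have hsum : (∫ s in (0 : ℝ)..t, m • ρs • P'' (u s))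
        + (∫ s in (0 : ℝ)..t, ρs • (-((1 / κ) • P' (S s)) - m • P'' (u s)))
        + (∫ s in (0 : ℝ)..t, (β • (b • P' (ρ s) - (1 / ρs) • P' (S s)) + β • Q (f₂ s)))
        = ∫ s in (0 : ℝ)..t, (-(c • m • P' (ρ s) + c • ρs • P' (S s) + c • β • P (u s))
          + ((c * β) • P (u s) + β • Q (f₂ s))) := by
      rw [← intervalIntegral.integral_add, ← intervalIntegral.integral_add]
      · congr 1 with s
        simp only [RCLike.real_smul_eq_coe_mul]
        have h1 : (β : 𝕜) * (b : 𝕜) = -((c : 𝕜) * (m : 𝕜)) := by exact_mod_cast congrArg (RCLike.ofReal (K := 𝕜)) hβb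
        have h2 : (ρs : 𝕜) * ((1 / κ : ℝ) : 𝕜) + (β : 𝕜) * ((1 / ρs : ℝ) : 𝕜) = (c : 𝕜) * (ρs : 𝕜) := by
          have : ρs * (1 / κ) + β * (1 / ρs) = c * ρs := by rw [← hβr]; ring
          exact_mod_cast congrArg (RCLike.ofReal (K := 𝕜)) this
        rw [RCLike.ofReal_mul c β]
        -- The `H''` terms `m ρs ⟨u, H''⟩` cancel between the density and stress equations.
        linear_combination P' (ρ s) * h1 - P' (S s) * h2
      · exact iA.add iB
      · exact iD
      · exact iA
      · exact iB
    rw [← hsum]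
    ring
  · simp [hFdef, hρT, huT, hST]
  · intro t ht
    have hle : ∀ s, ‖(c * β) • P (u s) + β • Q (f₂ s)‖ ≤
        (|c * β| * ‖u s‖ + |β| * ‖f₂ s‖) * N := by
      intro s
      calc ‖(c * β) • P (u s) + β • Q (f₂ s)‖
          ≤ |c * β| * ‖P (u s)‖ + |β| * ‖Q (f₂ s)‖ := by
            refine (norm_add_le _ _).trans_eq ?_
            rw [norm_smul, norm_smul, Real.norm_eq_abs, Real.norm_eq_abs]
        _ ≤ |c * β| * (N * ‖u s‖) + |β| * (N * ‖f₂ s‖) := by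
            gcongr
            · exact (hPn _).trans (by gcongr; exact hN _)
            · exact (hQn _).trans (by gcongr; exact hN _)
        _ = _ := by ring
    rw [hR, ← intervalIntegral.integral_mul_const]
    refine (intervalIntegral.norm_integral_le_of_norm_le ht.1
      (Filter.Eventually.of_forall fun s _ => hle s) ?_).trans ?_
    · exact (hRint.mul_const N).mono_set (by
        rw [uIcc_of_le ht.1, uIcc_of_le hT.le]; exact Icc_subset_Icc_right ht.2)
    · exact intervalIntegral.integral_mono_interval le_rfl ht.1 ht.2
        (Filter.Eventually.of_forall fun s => by positivity) (hRint.mul_const N)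

theorem theorem1p1 (𝕜 : Type*) [RCLike 𝕜] (a γ ρs μ κ : ℝ)
    (ha : 0 < a) (hγ : 1 ≤ γ) (hρs : 0 < ρs) (hμ : 0 < μ) (hκ : 0 < κ)
    (O₁ O₂ O₃ : Set ℝ) (hO₁ : IsOpen O₁) (hO₂ : IsOpen O₂) (hO₃ : IsOpen O₃)
    (hO₁π : O₁ ⊆ Ioo 0 Real.pi) (hO₂π : O₂ ⊆ Ioo 0 Real.pi) (hO₃π : O₃ ⊆ Ioo 0 Real.pi)
    (hne : (Ioo 0 Real.pi \ closure (O₁ ∪ O₃)).Nonempty) (T : ℝ) (hT : 0 < T) :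
    ¬ NullControllable 𝕜 a γ ρs μ κ O₁ O₂ O₃ T := by
  intro hnull
  obtain ⟨x₀, hx₀⟩ := hne
  have hU : Ioo 0 Real.pi \ closure (O₁ ∪ O₃) ∈ nhds x₀ :=
    (isOpen_Ioo.sdiff isClosed_closure).mem_nhds hx₀
  -- The initial density jumps at `x₀`, so its weak derivative there is a Dirac mass.
  have hstep : MemLp ((Ioi x₀).indicator fun _ => (1 : 𝕜)) 2 (volume.restrict (Ioo 0 Real.pi)) :=
    (memLp_const 1).indicator measurableSet_Ioi
  obtain ⟨f₁, f₂, f₃, ρ, u, S, hsol, hρT, huT, hST⟩ := hnull (hstep.toLp _) 0 0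
  obtain ⟨β, C, hC, hbound⟩ :=
    exists_norm_initial_pairing_le ha hγ hρs hμ hκ hT hsol hρT huT hST
  have hm : 0 < μ / κ := by positivity
  -- This size gives `C * η < μ / κ`; the `+ 1` covers `C = 0`.
  obtain ⟨H, hH, hHc, hHs, hH1, hHn⟩ := exists_bump_eLpNorm_le x₀ hU
    (η := μ / κ / (C + 1)) (by positivity)
  have hzero : ∀ φ : ℝ → ℝ,
      ∫ x in Ioo 0 Real.pi, φ x • (0 : L2 𝕜 (Ioo 0 Real.pi)) x = 0 := fun φ => by
    refine integral_eq_zero_of_ae ?_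
    filter_upwards [Lp.coeFn_zero 𝕜 2 (volume.restrict (Ioo 0 Real.pi))] with x hx
    exact (congrArg (φ x • ·) hx).trans (smul_zero _)
  have hjump : ∫ x in Ioo 0 Real.pi, deriv H x • (hstep.toLp _) x = (-1 : 𝕜) := by
    have hHπ : H Real.pi = 0 := by
      by_contra hne
      exact lt_irrefl _ (hHs (subset_tsupport _ hne)).1.2
    calc ∫ x in Ioo 0 Real.pi, deriv H x • (hstep.toLp _) x
        = ∫ x in Ioo 0 Real.pi, (Ioi x₀).indicator (fun x => ((deriv H x : ℝ) : 𝕜)) x := by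
          refine integral_congr_ae ?_
          filter_upwards [hstep.coeFn_toLp] with x hx
          rw [hx]
          by_cases hxx : x ∈ Ioi x₀ <;> simp [hxx, RCLike.real_smul_eq_coe_mul]
      _ = ∫ x in Ioo x₀ Real.pi, ((deriv H x : ℝ) : 𝕜) := by
          rw [setIntegral_indicator measurableSet_Ioi]
          congr 2
          ext x
          simp only [mem_inter_iff, mem_Ioo, mem_Ioi]
          exact ⟨fun h => ⟨h.2, h.1.2⟩, fun h => ⟨⟨hx₀.1.1.trans h.1, h.2⟩, h.1⟩⟩
      _ = ((∫ x in x₀..Real.pi, deriv H x : ℝ) : 𝕜) := by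
          rw [integral_ofReal, intervalIntegral.integral_of_le hx₀.1.2.le,
            integral_Ioc_eq_integral_Ioo]
      _ = -1 := by
          rw [intervalIntegral.integral_deriv_eq_sub
            (fun x _ => hH.differentiable (by simp) x)
            ((contDiff_infty_iff_deriv.1 hH).2.continuous.intervalIntegrable _ _), hHπ, hH1]
          simp
  have hlt := hbound H hH hHc hHs
  rw [hzero, hzero, hjump, smul_zero, smul_zero, add_zero, add_zero, norm_smul, norm_neg, norm_one,
    mul_one, Real.norm_of_nonneg hm.le] at hlt
  have hn : (eLpNorm H 2 volume).toReal ≤ μ / κ / (C + 1) :=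
    ENNReal.toReal_le_of_le_ofReal (by positivity) hHn
  have : C * (μ / κ / (C + 1)) < μ / κ := by
    rw [← mul_div_assoc, div_lt_iff₀ (by positivity)]
    linarith
  linarith [mul_le_mul_of_nonneg_left hn hC]
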